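/- Let $A=F(\mathbb{KP})=\mathbb C\oplus\mathbb C\oplus\mathbb C\oplus\mathbb C\oplus M_2(\mathbb C)$ be the $*$-algebra of functions on the Kac–Paljutkin quantum group, with basis $e_1,\dots,e_4$ of the one-dimensional summands, matrix units $E_{ij}$ ($i,j\in\{1,2\}$) of $M_2(\mathbb C)$, and dual basis $e^i,E^{ij}$ of $A^*$. Its comultiplication $\Delta$ is $$\begin{aligned} \Delta(e_1)&=e_1\otimes e_1+e_2\otimes e_2+e_3\otimes e_3+e_4\otimes e_4+\tfrac12\sum_{i,j}E_{ij}\otimes E_{ij},\\ \Delta(e_2)&=\{e_1,e_2\}+\{e_3,e_4\}+\tfrac12\{E_{11},E_{22}\}+\tfrac i2(E_{21}\otimes E_{12}-E_{12}\otimes E_{21}),\\ \Delta(e_3)&=\{e_1,e_3\}+\{e_2,e_4\}+\tfrac12\{E_{11},E_{22}\}-\tfrac i2(E_{21}\otimes E_{12}-E_{12}\otimes E_{21}),\\ \Delta(e_4)&=\{e_1,e_4\}+\{e_2,e_3\}+\tfrac12(E_{11}\otimes E_{11}-E_{12}\otimes E_{12}-E_{21}\otimes E_{21}+E_{22}\otimes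 E_{22}),\\ \Delta(E_{11})&=\{e_1,E_{11}\}+\{e_2,E_{22}\}+\{e_3,E_{22}\}+\{e_4,E_{11}\},\\ \Delta(E_{12})&=\{e_1,E_{12}\}+i[e_2,E_{21}]-i[e_3,E_{21}]-\{e_4,E_{12}\},\\ \Delta(E_{21})&=\{e_1,E_{21}\}-i[e_2,E_{12}]+i[e_3,E_{12}]-\{e_4,E_{21}\},\\ \Delta(E_{22})&=\{e_1,E_{22}\}+\{e_2,E_{11}\}+\{e_3,E_{11}\}+\{e_4,E_{22}\}, \end{aligned}$$ where $\{a,b\}=a\otimes b+b\otimes a$ and $[a,b]=a\otimes b-b\otimes a$. The counit is $\varepsilon=e^1$, the antipode $S$ is the identity on the first four summands and the transpose on $M_2(\mathbb C)$, and the Haar state is $\pi=\int=\frac18(e^1+e^2+e^3+e^4+2E^{11}+2E^{22})$. For functionals let $\mu\star\nu=(\mu\otimes\nu)\Delta$, $\nu^{\star 0}=\varepsilon$, $\nu^{\star(k+1)}=\nu^{\star k}\star\nu$. The map $\mathcal F:A\to A^*$, $\mathcal F(a)(b)=\int ba$, is bijective, and the total variation distance of functionals $\mu$ and $\nu$ is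 $\|\mu-\nu\|=\frac12\int\big|\mathcal F^{-1}(\mu-\nu)\big|$, where $|a|=(a^*a)^{1/2}$. A state $\nu$ is symmetric if $\nu=\nu\circ S$. For $\mu_1,\dots,\mu_5\ge 0$ with $\sum_i\mu_i=1$ and $x,y,z\in\mathbb R$ with $x^2+y^2+z^2\le1$ let $$\nu_{\mu,x,y,z}=\sum_{i=1}^4\mu_ie^i+\frac{\mu_5}{2}\big((1+z)E^{11}+(x-iy)E^{12}+(x+iy)E^{21}+(1-z)E^{22}\big).$$ (a) The symmetric states on $A$ are exactly the functionals $\nu_{\mu,x,0,z}$ with such parameters. (b) If $\nu=\nu_{\mu,x,y,z}$, with such parameters, is symmetric, then for every integer $k\ge0$ (with $0^0=1$) $$\begin{aligned}\|\nu^{\star k}-\pi\|^2\le{}&\tfrac14(\mu_1-\mu_2-\mu_3+\mu_4-z\mu_5)^{2k}+\tfrac14(\mu_1-\mu_2-\mu_3+\mu_4+z\mu_5)^{2k}+\tfrac14(\mu_1+\mu_2+\mu_3+\mu_4-\mu_5)^{2k}\\&+\tfrac12\Big(\mu_1-\mu_4+\sqrt{(\mu_2-\mu_3)^2+\tfrac{\mu_5^2x^2}{2}}\Big)^{2k}+\tfrac12\Big(\mu_1-\mu_4-\sqrt{(\mu_2-\mu_3)^2+\tfrac{\mu_5^2x^2}{2}}\Big)^{2k}.\end{aligned}$$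 (c) The functional $\nu=\frac14(e^3+e^4)+\frac14(E^{11}+E^{12}+E^{21}+E^{22})$ is a symmetric state, and with $\alpha=2+\sqrt3$ and $\beta=2-\sqrt3$, for every integer $k\ge0$, $$\frac1{2\sqrt6}\Big((8\beta)^{-k/2}-(8\alpha)^{-k/2}\Big)\le\|\nu^{\star k}-\pi\|\le\Big(\frac{\sqrt3+1}{4}\Big)^k.$$ -/

import Mathlib

open scoped TensorProduct

noncomputable section

namespace KacPaljutkin

/-- The underlying *-algebra `ℂ ⊕ ℂ ⊕ ℂ ⊕ ℂ ⊕ M₂(ℂ)` of the Kac–Paljutkin quantum group, with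
componentwise product and componentwise involution (conjugation, conjugate transpose). -/
abbrev Fun : Type := (Fin 4 → ℂ) × Matrix (Fin 2) (Fin 2) ℂ

/-- The group ring of the quantum group: all linear functionals on `Fun`. -/
abbrev Dual : Type := Fun →ₗ[ℂ] ℂ

/-- The basis vectors of the one-dimensional summands (`e 0, …, e 3` are `e₁, …, e₄`). -/
def e (i : Fin 4) : Fun := (Pi.single i 1, 0)

/-- The matrix units of the summand `M₂(ℂ)` (indices shifted by one). -/
def a (j k : Fin 2) : Fun := (0, Matrix.single j k 1)

/-- The functionals dual to `e i`. -/
def eDual (i : Fin 4) : Dual := LinearMap.proj i ∘ₗ LinearMap.fst ℂ _ _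

/-- The functionals dual to `a j k`. -/
def aDual (j k : Fin 2) : Dual := Matrix.entryLinearMap ℂ ℂ j k ∘ₗ LinearMap.snd ℂ _ _

/-- The values of the comultiplication at `e₁, …, e₄`. -/
def comulE : Fin 4 → Fun ⊗[ℂ] Fun :=
  ![e 0 ⊗ₜ e 0 + e 1 ⊗ₜ e 1 + e 2 ⊗ₜ e 2 + e 3 ⊗ₜ e 3
      + (1 / 2 : ℂ) • (a 0 0 ⊗ₜ a 0 0 + a 0 1 ⊗ₜ a 0 1 + a 1 0 ⊗ₜ a 1 0 + a 1 1 ⊗ₜ a 1 1),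
    e 0 ⊗ₜ e 1 + e 1 ⊗ₜ e 0 + e 2 ⊗ₜ e 3 + e 3 ⊗ₜ e 2
      + (1 / 2 : ℂ) • (a 0 0 ⊗ₜ a 1 1 + a 1 1 ⊗ₜ a 0 0)
      + (Complex.I / 2) • (a 1 0 ⊗ₜ a 0 1 - a 0 1 ⊗ₜ a 1 0),
    e 0 ⊗ₜ e 2 + e 2 ⊗ₜ e 0 + e 1 ⊗ₜ e 3 + e 3 ⊗ₜ e 1
      + (1 / 2 : ℂ) • (a 0 0 ⊗ₜ a 1 1 + a 1 1 ⊗ₜ a 0 0)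
      - (Complex.I / 2) • (a 1 0 ⊗ₜ a 0 1 - a 0 1 ⊗ₜ a 1 0),
    e 0 ⊗ₜ e 3 + e 3 ⊗ₜ e 0 + e 1 ⊗ₜ e 2 + e 2 ⊗ₜ e 1
      + (1 / 2 : ℂ) • (a 0 0 ⊗ₜ a 0 0 - a 0 1 ⊗ₜ a 0 1 - a 1 0 ⊗ₜ a 1 0 + a 1 1 ⊗ₜ a 1 1)]

/-- The values of the comultiplication at the matrix units. -/
def comulA : Fin 2 → Fin 2 → Fun ⊗[ℂ] Fun :=
  ![![e 0 ⊗ₜ a 0 0 + a 0 0 ⊗ₜ e 0 + e 1 ⊗ₜ a 1 1 + a 1 1 ⊗ₜ e 1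
        + e 2 ⊗ₜ a 1 1 + a 1 1 ⊗ₜ e 2 + e 3 ⊗ₜ a 0 0 + a 0 0 ⊗ₜ e 3,
      e 0 ⊗ₜ a 0 1 + a 0 1 ⊗ₜ e 0 + Complex.I • (e 1 ⊗ₜ a 1 0 - a 1 0 ⊗ₜ e 1)
        - Complex.I • (e 2 ⊗ₜ a 1 0 - a 1 0 ⊗ₜ e 2) - e 3 ⊗ₜ a 0 1 - a 0 1 ⊗ₜ e 3],
    ![e 0 ⊗ₜ a 1 0 + a 1 0 ⊗ₜ e 0 - Complex.I • (e 1 ⊗ₜ a 0 1 - a 0 1 ⊗ₜ e 1)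
        + Complex.I • (e 2 ⊗ₜ a 0 1 - a 0 1 ⊗ₜ e 2) - e 3 ⊗ₜ a 1 0 - a 1 0 ⊗ₜ e 3,
      e 0 ⊗ₜ a 1 1 + a 1 1 ⊗ₜ e 0 + e 1 ⊗ₜ a 0 0 + a 0 0 ⊗ₜ e 1
        + e 2 ⊗ₜ a 0 0 + a 0 0 ⊗ₜ e 2 + e 3 ⊗ₜ a 1 1 + a 1 1 ⊗ₜ e 3]]

/-- The comultiplication: the linear extension of its values on the basis. -/
def comul : Fun →ₗ[ℂ] Fun ⊗[ℂ] Fun :=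
  (∑ i, (eDual i).smulRight (comulE i)) + ∑ j, ∑ k, (aDual j k).smulRight (comulA j k)

/-- The counit: the coefficient of `e₁`. -/
def counit : Dual := eDual 0

/-- The antipode: the identity on the one-dimensional summands, the transpose on `M₂(ℂ)`. -/
def antipode : Fun →ₗ[ℂ] Fun :=
  LinearMap.prodMap LinearMap.id (Matrix.transposeLinearEquiv (Fin 2) (Fin 2) ℂ ℂ).toLinearMap

/-- The Haar state `π = ∫`. -/
def haar : Dual := (1 / 8 : ℂ) • ((∑ i, eDual i) + (2 : ℂ) • (aDual 0 0 + aDual 1 1))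

/-- Convolution of functionals, `μ ⋆ ν = (μ ⊗ ν) ∘ Δ`. -/
def conv (μ ν : Dual) : Dual := LinearMap.mul' ℂ ℂ ∘ₗ TensorProduct.map μ ν ∘ₗ comul

/-- Convolution powers; the counit is the unit for convolution. -/
def convPow (ν : Dual) : ℕ → Dual
  | 0 => counit
  | k + 1 => conv (convPow ν k) ν

section

open scoped ComplexOrder

/-- States: positive linear functionals of value one at the unit. -/
def IsState (ν : Dual) : Prop := (∀ f : Fun, 0 ≤ ν (star f * f)) ∧ ν 1 = 1

end

/-- Symmetric functionals, `ν = ν ∘ S`. -/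
def IsSymmetric (ν : Dual) : Prop := ν = ν ∘ₗ antipode

/-- The transform `f ↦ (g ↦ ∫ g f)` from functions to functionals. -/
def fourier : Fun →ₗ[ℂ] Dual := (LinearMap.mul ℂ Fun).flip.compr₂ haar

theorem fourier_apply (f g : Fun) : fourier f g = haar (g * f) := rfl

theorem fourier_bijective : Function.Bijective fourier := by
  have hinj : Function.Injective fourier := by
    rw [← LinearMap.ker_eq_bot, LinearMap.ker_eq_bot']
    intro f hf
    have h : ∀ g, haar (g * f) = 0 := fun g => by rw [← fourier_apply, hf]; rfl
    ext i j
    · have := h (e i)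
      fin_cases i <;>
        simpa [haar, eDual, aDual, e, Fin.sum_univ_four, Pi.single_apply] using this
    · have := h (a j i)
      fin_cases i <;> fin_cases j <;>
        simpa [haar, eDual, aDual, a, Fin.sum_univ_four, Matrix.mul_apply, Matrix.single] using this
  exact ⟨hinj, (LinearMap.injective_iff_surjective_of_finrank_eq_finrank
    Subspace.dual_finrank_eq.symm).1 hinj⟩

/-- The transform as a linear isomorphism. -/
def fourierEquiv : Fun ≃ₗ[ℂ] Dual := LinearEquiv.ofBijective fourier fourier_bijective

section

open scoped Matrix.Norms.L2Operator MatrixOrder ComplexOrder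

/-- The one-norm `‖f‖₁ = ∫ |f|` with `|f| = (f* f)^{1/2}`; the integral of the positive element
`|f|` is a non-negative real number. -/
def oneNorm (f : Fun) : ℝ := (haar (CFC.abs f)).re

end

/-- The total variation distance of two functionals. -/
def tvDist (μ ν : Dual) : ℝ := (1 / 2) * oneNorm (fourierEquiv.symm (μ - ν))

/-- The functional with parameters `μ₁, …, μ₅` and `x, y, z`. -/
def paramState (μ₁ μ₂ μ₃ μ₄ μ₅ x y z : ℝ) : Dual :=
  (μ₁ : ℂ) • eDual 0 + (μ₂ : ℂ) • eDual 1 + (μ₃ : ℂ) • eDual 2 + (μ₄ : ℂ) • eDual 3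
    + ((μ₅ : ℂ) / 2) • ((1 + (z : ℂ)) • aDual 0 0 + ((x : ℂ) - Complex.I * y) • aDual 0 1
      + ((x : ℂ) + Complex.I * y) • aDual 1 0 + (1 - (z : ℂ)) • aDual 1 1)

/-- The parameters are admissible: convex weights and a point of the closed unit ball. -/
def IsParam (μ₁ μ₂ μ₃ μ₄ μ₅ x y z : ℝ) : Prop :=
  0 ≤ μ₁ ∧ 0 ≤ μ₂ ∧ 0 ≤ μ₃ ∧ 0 ≤ μ₄ ∧ 0 ≤ μ₅ ∧ μ₁ + μ₂ + μ₃ + μ₄ + μ₅ = 1 ∧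
    x ^ 2 + y ^ 2 + z ^ 2 ≤ 1

/-- The state `(e³ + e⁴) / 4 + (E¹¹ + E¹² + E²¹ + E²²) / 4`. -/
def exampleState : Dual :=
  (1 / 4 : ℂ) • (eDual 2 + eDual 3)
    + (1 / 4 : ℂ) • (aDual 0 0 + aDual 0 1 + aDual 1 0 + aDual 1 1)

end KacPaljutkin

end

namespace KacPaljutkin

/-! A symmetric state has a real symmetric density on `M₂(ℂ)`. Convolution has four characters, with
values `1` and the bases of the first three terms in (b), and a two-dimensional block `(n₁ - n₄) + b
M`, `M² = D²`, with eigenvalues `n₁ - n₄ ± b D`; here `D² = (m₂ - m₃)² + 2w²`. Along the powers of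
one state `M` stays fixed and only `n₁ - n₄` and `b` change, so everything is diagonal
(`exists_convPow_realSymm`). Cauchy–Schwarz bounds the distance by half the `L²` norm of the density
(`sq_tvDist_realSymm_haar_le`), and Plancherel turns its square into the sum in (b). For (a),
positivity on `M₂(ℂ)` amounts to a nonnegative real quadratic form, that is, to `x² + z² ≤ 1`. In
(c) the nontrivial characters vanish, and the lower bound comes from `n₁ - n₄`, half the trace of
the block. -/

theorem dual_ext {μ ν : Dual} (he : ∀ i, μ (e i) = ν (e i))
    (ha : ∀ j k, μ (a j k) = ν (a j k)) : μ = ν := by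
  have hf (f : Fun) : f = (∑ i, f.1 i • e i) + ∑ j, ∑ k, f.2 j k • a j k := by
    ext i j
    · fin_cases i <;> simp [e, a, Fin.sum_univ_four]
    · fin_cases i <;> fin_cases j <;> simp [e, a, Fin.sum_univ_four, Matrix.single]
  refine LinearMap.ext fun f => ?_
  rw [hf f]
  simp [he, ha]

@[simp] theorem eDual_e (i j : Fin 4) : eDual i (e j) = if i = j then 1 else 0 := by
  simp [eDual, e, Pi.single_apply]

@[simp] theorem eDual_a (i : Fin 4) (j k : Fin 2) : eDual i (a j k) = 0 := by
  simp [eDual, a]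

@[simp] theorem aDual_e (i : Fin 4) (j k : Fin 2) : aDual j k (e i) = 0 := by
  simp [aDual, e]

@[simp] theorem aDual_a (i j k l : Fin 2) :
    aDual i j (a k l) = if i = k ∧ j = l then 1 else 0 := by
  fin_cases i <;> fin_cases j <;> fin_cases k <;> fin_cases l <;> simp [aDual, a, Matrix.single]

theorem comul_e (i : Fin 4) : comul (e i) = comulE i := by
  simp [comul]

theorem comul_a (j k : Fin 2) : comul (a j k) = comulA j k := by
  fin_cases j <;> fin_cases k <;> simp [comul]

/-! ### Convolution of real symmetric functionals -/

/-- The functional with real weights on the one-dimensional summands and a real symmetric density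
`[[s, r], [r, t]]` on the matrix summand. -/
def realSymm (n₁ n₂ n₃ n₄ s t r : ℝ) : Dual :=
  (n₁ : ℂ) • eDual 0 + (n₂ : ℂ) • eDual 1 + (n₃ : ℂ) • eDual 2 + (n₄ : ℂ) • eDual 3
    + (s : ℂ) • aDual 0 0 + (r : ℂ) • aDual 0 1 + (r : ℂ) • aDual 1 0 + (t : ℂ) • aDual 1 1

/-- The commutator terms of `Δ(E₁₂)` and `Δ(E₂₁)` contribute `±i ((n₂ - n₃) w - r (m₂ - m₃))`; the
hypothesis kills exactly this antisymmetric part. -/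
theorem conv_realSymm {n₁ n₂ n₃ n₄ s t r m₁ m₂ m₃ m₄ u v w : ℝ}
    (h : (n₂ - n₃) * w = r * (m₂ - m₃)) :
    conv (realSymm n₁ n₂ n₃ n₄ s t r) (realSymm m₁ m₂ m₃ m₄ u v w) =
      realSymm (n₁ * m₁ + n₂ * m₂ + n₃ * m₃ + n₄ * m₄ + (s * u + 2 * (r * w) + t * v) / 2)
        (n₁ * m₂ + n₂ * m₁ + n₃ * m₄ + n₄ * m₃ + (s * v + t * u) / 2)
        (n₁ * m₃ + n₃ * m₁ + n₂ * m₄ + n₄ * m₂ + (s * v + t * u) / 2)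
        (n₁ * m₄ + n₄ * m₁ + n₂ * m₃ + n₃ * m₂ + (s * u - 2 * (r * w) + t * v) / 2)
        ((n₁ + n₄) * u + (m₁ + m₄) * s + (n₂ + n₃) * v + (m₂ + m₃) * t)
        ((n₁ + n₄) * v + (m₁ + m₄) * t + (n₂ + n₃) * u + (m₂ + m₃) * s)
        ((n₁ - n₄) * w + (m₁ - m₄) * r) := by
  have hc : ((n₂ : ℂ) - n₃) * w = r * (m₂ - m₃) := by exact_mod_cast h
  refine dual_ext (fun i => ?_) fun j k => ?_
  · fin_cases i <;> simp [conv, comul_e, comulE, realSymm] <;> ring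
  · fin_cases j <;> fin_cases k <;> simp [conv, comul_a, comulA, realSymm]
    · ring
    · linear_combination Complex.I * hc
    · linear_combination -Complex.I * hc
    · ring

theorem paramState_eq_realSymm {μ₁ μ₂ μ₃ μ₄ μ₅ x y z : ℝ} (h : μ₅ * y = 0) :
    paramState μ₁ μ₂ μ₃ μ₄ μ₅ x y z =
      realSymm μ₁ μ₂ μ₃ μ₄ (μ₅ / 2 * (1 + z)) (μ₅ / 2 * (1 - z)) (μ₅ / 2 * x) := by
  rw [mul_eq_zero] at h
  refine dual_ext (fun i => ?_) fun j k => ?_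
  · fin_cases i <;> simp [paramState, realSymm]
  · rcases h with rfl | rfl <;> fin_cases j <;> fin_cases k <;> simp [paramState, realSymm]

/-- Only the product vanishes: when `μ₅ = 0` the value of `y` is arbitrary. -/
theorem mul_eq_zero_of_isSymmetric {μ₁ μ₂ μ₃ μ₄ μ₅ x y z : ℝ}
    (h : IsSymmetric (paramState μ₁ μ₂ μ₃ μ₄ μ₅ x y z)) : μ₅ * y = 0 := by
  have h₁ := LinearMap.congr_fun h (a 0 1)
  have h₂ : antipode (a 0 1) = a 1 0 := by
    simp [antipode, a]
  simp only [LinearMap.comp_apply, h₂] at h₁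
  have h₃ := congrArg Complex.im h₁
  simp [paramState] at h₃
  linarith

theorem exampleState_eq_paramState :
    exampleState = paramState 0 0 (1 / 4) (1 / 4) (1 / 2) 1 0 0 := by
  refine dual_ext (fun i => ?_) fun j k => ?_
  · fin_cases i <;> simp [paramState, exampleState]
  · fin_cases j <;> fin_cases k <;> simp [paramState, exampleState] <;> norm_num

theorem counit_eq_realSymm : counit = realSymm 1 0 0 0 0 0 0 := by
  simp [counit, realSymm]

theorem realSymm_sub_haar (n₁ n₂ n₃ n₄ s t r : ℝ) :
    realSymm n₁ n₂ n₃ n₄ s t r - haar =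
      realSymm (n₁ - 1 / 8) (n₂ - 1 / 8) (n₃ - 1 / 8) (n₄ - 1 / 8) (s - 1 / 4) (t - 1 / 4) r := by
  refine dual_ext (fun i => ?_) fun j k => ?_
  · fin_cases i <;> simp [realSymm, haar]
  · fin_cases j <;> fin_cases k <;> simp [realSymm, haar] <;> norm_num

/-- The density of `realSymm` with respect to the Haar state. -/
theorem fourierEquiv_symm_realSymm (n₁ n₂ n₃ n₄ s t r : ℝ) :
    fourierEquiv.symm (realSymm n₁ n₂ n₃ n₄ s t r) =
      (![8 * (n₁ : ℂ), 8 * n₂, 8 * n₃, 8 * n₄], !![4 * (s : ℂ), 4 * r; 4 * r, 4 * t]) := by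
  rw [LinearEquiv.symm_apply_eq]
  refine dual_ext (fun i => ?_) fun j k => ?_ <;>
    simp only [fourierEquiv, LinearEquiv.ofBijective_apply, fourier_apply]
  · fin_cases i <;>
      simp [realSymm, haar, eDual, aDual, e, Fin.sum_univ_four]
  · fin_cases j <;> fin_cases k <;>
      simp [realSymm, haar, eDual, aDual, a, Fin.sum_univ_four, Matrix.mul_apply, Matrix.single] <;>
      ring

/-! ### Total variation and the `L²` bound -/

section

open scoped Matrix.Norms.L2Operator MatrixOrder ComplexOrder

theorem abs_fst (f : Fun) (i : Fin 4) : (CFC.abs f).1 i = (‖f.1 i‖ : ℂ) := by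
  have h₀ : (0 : ℂ) ≤ (CFC.abs f).1 i := (CFC.abs_nonneg f).1 i
  have h₁ : (CFC.abs f).1 i * (CFC.abs f).1 i = star (f.1 i) * f.1 i :=
    congrFun (congrArg Prod.fst (CFC.abs_mul_abs f)) i
  have h₂ := congrArg (‖·‖) h₁
  simp only [norm_mul, norm_star] at h₂
  rw [← (mul_self_inj (norm_nonneg _) (norm_nonneg _)).1 h₂]
  exact (RCLike.norm_of_nonneg' h₀).symm

/-- The one-norm splits into the moduli of the scalar components and the trace of the modulus of
the matrix component, which is bounded by the Hilbert–Schmidt norm. -/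
theorem exists_oneNorm_eq (f : Fun) :
    ∃ T : ℝ, 0 ≤ T ∧ T ^ 2 ≤ 2 * ((star f.2 * f.2).trace).re ∧
      oneNorm f = 1 / 8 * ∑ i, ‖f.1 i‖ + 1 / 4 * T := by
  have hpos : (CFC.abs f).2.PosSemidef := Matrix.nonneg_iff_posSemidef.1 (CFC.abs_nonneg f).2
  have hsq : (CFC.abs f).2 * (CFC.abs f).2 = star f.2 * f.2 :=
    congrArg Prod.snd (CFC.abs_mul_abs f)
  have hone : oneNorm f = 1 / 8 * ∑ i, ‖f.1 i‖ + 1 / 4 * (CFC.abs f).2.trace.re := by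
    simp only [oneNorm, haar, eDual, aDual]
    simp [abs_fst, Matrix.trace_fin_two]
    ring
  refine ⟨(CFC.abs f).2.trace.re, (Complex.nonneg_iff.1 hpos.trace_nonneg).1, ?_, hone⟩
  rw [← hsq]
  generalize (CFC.abs f).2 = H at hpos
  have h₁ := hpos.isHermitian.apply 0 1
  have h₂ := hpos.isHermitian.apply 0 0
  have h₃ := hpos.isHermitian.apply 1 1
  simp only [Complex.ext_iff, Complex.star_def, Complex.conj_re, Complex.conj_im] at h₁ h₂ h₃
  simp only [Matrix.trace_fin_two, Matrix.mul_apply, Fin.sum_univ_two, Complex.add_re,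
    Complex.mul_re]
  rw [h₁.1, show (H 1 0).im = -(H 0 1).im by linarith [h₁.2], show (H 0 0).im = 0 by linarith [h₂.2],
    show (H 1 1).im = 0 by linarith [h₃.2]]
  -- For Hermitian `H` of size two, `(tr H)² ≤ 2 tr H²`.
  nlinarith [sq_nonneg ((H 0 0).re - (H 1 1).re), sq_nonneg (H 0 1).re, sq_nonneg (H 0 1).im]

end

theorem exists_tvDist_realSymm_haar (n₁ n₂ n₃ n₄ s t r : ℝ) :
    ∃ T : ℝ, 0 ≤ T ∧ T ^ 2 ≤ 2 * ((s - 1 / 4) ^ 2 + (t - 1 / 4) ^ 2 + 2 * r ^ 2) ∧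
      tvDist (realSymm n₁ n₂ n₃ n₄ s t r) haar =
        1 / 2 * (|n₁ - 1 / 8| + |n₂ - 1 / 8| + |n₃ - 1 / 8| + |n₄ - 1 / 8| + T) := by
  have hn (x : ℝ) : ‖(8 : ℂ) * (x : ℂ)‖ = 8 * |x| := by simp
  obtain ⟨T, h₀, h₁, h₂⟩ := exists_oneNorm_eq
    (fourierEquiv.symm (realSymm n₁ n₂ n₃ n₄ s t r - haar))
  refine ⟨T / 4, by positivity, ?_, ?_⟩
  · rw [realSymm_sub_haar, fourierEquiv_symm_realSymm] at h₁
    simp [Matrix.trace_fin_two, Matrix.mul_apply, Fin.sum_univ_two, Matrix.star_apply] at h₁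
    linarith
  · rw [tvDist, h₂, realSymm_sub_haar, fourierEquiv_symm_realSymm]
    simp only [Fin.sum_univ_four, Matrix.cons_val, hn]
    ring

theorem sq_tvDist_realSymm_haar_le (n₁ n₂ n₃ n₄ s t r : ℝ) :
    tvDist (realSymm n₁ n₂ n₃ n₄ s t r) haar ^ 2 ≤
      2 * ((n₁ - 1 / 8) ^ 2 + (n₂ - 1 / 8) ^ 2 + (n₃ - 1 / 8) ^ 2 + (n₄ - 1 / 8) ^ 2)
        + (s - 1 / 4) ^ 2 + (t - 1 / 4) ^ 2 + 2 * r ^ 2 := by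
  obtain ⟨T, -, h₁, h₂⟩ := exists_tvDist_realSymm_haar n₁ n₂ n₃ n₄ s t r
  rw [h₂, ← sq_abs (n₁ - 1 / 8), ← sq_abs (n₂ - 1 / 8), ← sq_abs (n₃ - 1 / 8),
    ← sq_abs (n₄ - 1 / 8)]
  generalize |n₁ - 1 / 8| = p₁, |n₂ - 1 / 8| = p₂, |n₃ - 1 / 8| = p₃, |n₄ - 1 / 8| = p₄
  -- Cauchy–Schwarz with Haar weights: `(P + T)² ≤ 2P² + 2T²` and `P² ≤ 4 ∑ pᵢ²`, where `P = ∑ pᵢ`.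
  have : (p₁ + p₂ + p₃ + p₄ + T) ^ 2 ≤
      8 * (p₁ ^ 2 + p₂ ^ 2 + p₃ ^ 2 + p₄ ^ 2) + 2 * T ^ 2 := by
    nlinarith [sq_nonneg (p₁ - p₂), sq_nonneg (p₁ - p₃), sq_nonneg (p₁ - p₄),
      sq_nonneg (p₂ - p₃), sq_nonneg (p₂ - p₄), sq_nonneg (p₃ - p₄),
      sq_nonneg (p₁ + p₂ + p₃ + p₄ - T)]
  linarith

/-! ### Diagonalisation of convolution powers -/

/-- Convolution powers of a symmetric state, diagonalised. -/
theorem exists_convPow_realSymm {m₁ m₂ m₃ m₄ u v w D : ℝ}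
    (hsum : m₁ + m₂ + m₃ + m₄ + u + v = 1) (hD : D ^ 2 = (m₂ - m₃) ^ 2 + 2 * w ^ 2) (k : ℕ) :
    ∃ n₁ n₂ n₃ n₄ s t b : ℝ,
      convPow (realSymm m₁ m₂ m₃ m₄ u v w) k = realSymm n₁ n₂ n₃ n₄ s t (b * w) ∧
      n₂ - n₃ = b * (m₂ - m₃) ∧
      n₁ + n₂ + n₃ + n₄ + s + t = 1 ∧
      n₁ + n₂ + n₃ + n₄ - s - t = (m₁ + m₂ + m₃ + m₄ - u - v) ^ k ∧
      n₁ - n₂ - n₃ + n₄ + s - t = (m₁ - m₂ - m₃ + m₄ + u - v) ^ k ∧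
      n₁ - n₂ - n₃ + n₄ - s + t = (m₁ - m₂ - m₃ + m₄ - u + v) ^ k ∧
      n₁ - n₄ + b * D = (m₁ - m₄ + D) ^ k ∧
      n₁ - n₄ - b * D = (m₁ - m₄ - D) ^ k := by
  induction k with
  | zero => exact ⟨1, 0, 0, 0, 0, 0, 0, by simp [convPow, counit_eq_realSymm]⟩
  | succ k ih =>
    obtain ⟨n₁, n₂, n₃, n₄, s, t, b, h₀, h₁, h₂, h₃, h₄, h₅, h₆, h₇⟩ := ih
    have hstep := conv_realSymm (n₁ := n₁) (n₂ := n₂) (n₃ := n₃) (n₄ := n₄) (s := s) (t := t)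
      (m₁ := m₁) (m₂ := m₂) (m₃ := m₃) (m₄ := m₄) (u := u) (v := v)
      (show (n₂ - n₃) * w = b * w * (m₂ - m₃) by rw [h₁]; ring)
    -- Factoring out `w` exhibits the next `b` as `n₁ - n₄ + (m₁ - m₄) b`.
    rw [← h₀, ← convPow, show (n₁ - n₄) * w + (m₁ - m₄) * (b * w) =
      (n₁ - n₄ + (m₁ - m₄) * b) * w by ring] at hstep
    refine ⟨_, _, _, _, _, _, _, hstep, ?_, ?_, ?_, ?_, ?_, ?_, ?_⟩
    · linear_combination (m₁ - m₄) * h₁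
    · linear_combination (m₁ + m₂ + m₃ + m₄ + u + v) * h₂ + hsum
    · rw [pow_succ, ← h₃]; ring
    · rw [pow_succ, ← h₄]; ring
    · rw [pow_succ, ← h₅]; ring
    · rw [pow_succ, ← h₆]; linear_combination (m₂ - m₃) * h₁ - b * hD
    · rw [pow_succ, ← h₇]; linear_combination (m₂ - m₃) * h₁ - b * hD

theorem sq_tvDist_convPow_realSymm_le {m₁ m₂ m₃ m₄ u v w D : ℝ}
    (hsum : m₁ + m₂ + m₃ + m₄ + u + v = 1) (hD : D ^ 2 = (m₂ - m₃) ^ 2 + 2 * w ^ 2) (k : ℕ) :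
    tvDist (convPow (realSymm m₁ m₂ m₃ m₄ u v w) k) haar ^ 2 ≤
      1 / 4 * (m₁ - m₂ - m₃ + m₄ - u + v) ^ (2 * k)
        + 1 / 4 * (m₁ - m₂ - m₃ + m₄ + u - v) ^ (2 * k)
        + 1 / 4 * (m₁ + m₂ + m₃ + m₄ - u - v) ^ (2 * k)
        + 1 / 2 * (m₁ - m₄ + D) ^ (2 * k) + 1 / 2 * (m₁ - m₄ - D) ^ (2 * k) := by
  obtain ⟨n₁, n₂, n₃, n₄, s, t, b, h₀, h₁, h₂, h₃, h₄, h₅, h₆, h₇⟩ :=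
    exists_convPow_realSymm hsum hD k
  rw [h₀]
  refine (sq_tvDist_realSymm_haar_le ..).trans_eq ?_
  simp only [mul_comm 2 k, pow_mul, ← h₃, ← h₄, ← h₅, ← h₆, ← h₇]
  obtain rfl : t = 1 - (n₁ + n₂ + n₃ + n₄ + s) := by linarith
  -- Plancherel: the `L²` bound equals the sum over eigenvalues exactly.
  linear_combination (n₂ - n₃ + b * (m₂ - m₃)) * h₁ - b ^ 2 * hD

/-! ### Symmetric states -/

/-- The quadratic form of a point of the unit disc is positive. -/
theorem quadratic_form_nonneg {x z : ℝ} (h : x ^ 2 + z ^ 2 ≤ 1) (p q : ℝ) :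
    0 ≤ (1 + z) * p ^ 2 + 2 * x * (p * q) + (1 - z) * q ^ 2 := by
  have hz : z ^ 2 ≤ 1 := by nlinarith [sq_nonneg x]
  have hz₁ : -1 ≤ z := by nlinarith
  have hz₂ : z ≤ 1 := by nlinarith
  -- Completing the square leaves `(1 - x² - z²) q²`. Adding the analogue for `1 - z` gives twice
  -- the form, so no division by `1 ± z` is needed.
  have h₁ : 0 ≤ (1 + z) * ((1 + z) * p ^ 2 + 2 * x * (p * q) + (1 - z) * q ^ 2) := by
    nlinarith [sq_nonneg ((1 + z) * p + x * q), mul_nonneg (sub_nonneg.2 h) (sq_nonneg q)]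
  have h₂ : 0 ≤ (1 - z) * ((1 + z) * p ^ 2 + 2 * x * (p * q) + (1 - z) * q ^ 2) := by
    nlinarith [sq_nonneg ((1 - z) * q + x * p), mul_nonneg (sub_nonneg.2 h) (sq_nonneg p)]
  linarith

theorem isSymmetric_realSymm (n₁ n₂ n₃ n₄ s t r : ℝ) :
    IsSymmetric (realSymm n₁ n₂ n₃ n₄ s t r) := by
  refine LinearMap.ext fun f => ?_
  simp [realSymm, antipode, eDual, aDual]
  ring

theorem isState_paramState {μ₁ μ₂ μ₃ μ₄ μ₅ x z : ℝ} (h : IsParam μ₁ μ₂ μ₃ μ₄ μ₅ x 0 z) :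
    IsState (paramState μ₁ μ₂ μ₃ μ₄ μ₅ x 0 z) := by
  obtain ⟨h₁, h₂, h₃, h₄, h₅, hs, hx⟩ := h
  have hq := quadratic_form_nonneg (x := x) (z := z) (by linarith)
  refine ⟨fun f => ?_, ?_⟩
  · have key : paramState μ₁ μ₂ μ₃ μ₄ μ₅ x 0 z (star f * f) =
        ((μ₁ * ‖f.1 0‖ ^ 2 + μ₂ * ‖f.1 1‖ ^ 2 + μ₃ * ‖f.1 2‖ ^ 2 + μ₄ * ‖f.1 3‖ ^ 2
          + μ₅ / 2 * ∑ j, (((1 + z) * (f.2 j 0).re ^ 2 + 2 * x * ((f.2 j 0).re * (f.2 j 1).re)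
            + (1 - z) * (f.2 j 1).re ^ 2) + ((1 + z) * (f.2 j 0).im ^ 2
            + 2 * x * ((f.2 j 0).im * (f.2 j 1).im) + (1 - z) * (f.2 j 1).im ^ 2)) : ℝ) : ℂ) := by
      rw [Complex.ext_iff]
      constructor <;>
        simp [paramState, eDual, aDual, Matrix.mul_apply, Matrix.star_apply, Fin.sum_univ_two,
          Complex.sq_norm, Complex.normSq_apply, -Complex.ofReal_add, -Complex.ofReal_mul] <;>
        ring
    rw [key]
    refine Complex.zero_le_real.2 ?_
    have := Finset.sum_nonneg fun j (_ : j ∈ Finset.univ) =>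
      add_nonneg (hq (f.2 j 0).re (f.2 j 1).re) (hq (f.2 j 0).im (f.2 j 1).im)
    positivity
  · have hs' : (μ₁ : ℂ) + μ₂ + μ₃ + μ₄ + μ₅ = 1 := by exact_mod_cast hs
    simp [paramState, eDual, aDual]
    linear_combination hs'

open scoped ComplexOrder in
theorem exists_paramState {ν : Dual} (hν : IsState ν) (hS : IsSymmetric ν) :
    ∃ μ₁ μ₂ μ₃ μ₄ μ₅ x z : ℝ, IsParam μ₁ μ₂ μ₃ μ₄ μ₅ x 0 z ∧
      ν = paramState μ₁ μ₂ μ₃ μ₄ μ₅ x 0 z := by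
  obtain ⟨hpos, hone⟩ := hν
  have he (i : Fin 4) : (0 : ℂ) ≤ ν (e i) := by
    have h : star (e i) * e i = e i := by
      ext j k
      · by_cases hj : j = i <;> simp [e, hj]
      · simp [e]
    exact h ▸ hpos (e i)
  have hS₁ : ν (a 1 0) = ν (a 0 1) := by
    have h₁ := LinearMap.congr_fun hS (a 0 1)
    have h₂ : antipode (a 0 1) = a 1 0 := by simp [antipode, a]
    rw [h₁, LinearMap.comp_apply, h₂]
  have hquad (p q : ℝ) : (0 : ℂ) ≤
      p ^ 2 * ν (a 0 0) + 2 * (p * q) * ν (a 0 1) + q ^ 2 * ν (a 1 1) := by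
    have h₁ := hpos ((p : ℂ) • a 0 0 + (q : ℂ) • a 0 1)
    have h₂ : star ((p : ℂ) • a 0 0 + (q : ℂ) • a 0 1) * ((p : ℂ) • a 0 0 + (q : ℂ) • a 0 1) =
        ((p : ℂ) ^ 2) • a 0 0 + ((p : ℂ) * q) • a 0 1 + ((p : ℂ) * q) • a 1 0
          + ((q : ℂ) ^ 2) • a 1 1 := by
      ext j k
      · simp [a]
      · fin_cases j <;> fin_cases k <;>
          simp [a, Matrix.mul_apply, Matrix.star_apply, Matrix.single] <;> ring
    rw [h₂] at h₁
    simp only [map_add, map_smul, smul_eq_mul, hS₁] at h₁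
    convert h₁ using 1
    ring
  have h00 : (0 : ℂ) ≤ ν (a 0 0) := by simpa using hquad 1 0
  have h11 : (0 : ℂ) ≤ ν (a 1 1) := by simpa using hquad 0 1
  have hsum : ν (e 0) + ν (e 1) + ν (e 2) + ν (e 3) + ν (a 0 0) + ν (a 1 1) = 1 := by
    rw [← hone, ← map_add, ← map_add, ← map_add, ← map_add, ← map_add]
    congr 1
    ext j k
    · fin_cases j <;> simp [e, a]
    · fin_cases j <;> fin_cases k <;> simp [e, a, Matrix.single]
  have h01 : (ν (a 0 1)).im = 0 := by
    have h₁ := (Complex.nonneg_iff.1 (hquad 1 1)).2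
    have h₂ := (Complex.nonneg_iff.1 h00).2
    have h₃ := (Complex.nonneg_iff.1 h11).2
    simp at h₁
    linarith
  have hreal {c : ℂ} (hc : 0 ≤ c) : ∃ x : ℝ, 0 ≤ x ∧ c = x :=
    ⟨c.re, (Complex.nonneg_iff.1 hc).1,
      Complex.ext rfl (by simpa using (Complex.nonneg_iff.1 hc).2.symm)⟩
  obtain ⟨m₁, hm₁, e₁⟩ := hreal (he 0)
  obtain ⟨m₂, hm₂, e₂⟩ := hreal (he 1)
  obtain ⟨m₃, hm₃, e₃⟩ := hreal (he 2)
  obtain ⟨m₄, hm₄, e₄⟩ := hreal (he 3)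
  obtain ⟨u, hu, eu⟩ := hreal h00
  obtain ⟨v, hv, ev⟩ := hreal h11
  obtain ⟨w, ew⟩ : ∃ w : ℝ, ν (a 0 1) = w := ⟨(ν (a 0 1)).re, Complex.ext rfl (by simpa using h01)⟩
  have hform (p q : ℝ) : 0 ≤ p ^ 2 * u + 2 * (p * q) * w + q ^ 2 * v := by
    have := hquad p q
    rw [eu, ev, ew] at this
    exact_mod_cast this
  have hsum' : m₁ + m₂ + m₃ + m₄ + u + v = 1 := by
    rw [e₁, e₂, e₃, e₄, eu, ev] at hsum
    exact_mod_cast hsum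
  have hν : ν = realSymm m₁ m₂ m₃ m₄ u v w := by
    refine dual_ext (fun i => ?_) fun j k => ?_
    · fin_cases i <;> simp [realSymm, e₁, e₂, e₃, e₄]
    · fin_cases j <;> fin_cases k <;> simp [realSymm, eu, ev, ew, hS₁]
  rcases (add_nonneg hu hv).eq_or_lt with h | h
  · obtain rfl : u = 0 := by linarith
    obtain rfl : v = 0 := by linarith
    -- The zero form leaves the disc point free; the origin is chosen.
    obtain rfl : w = 0 := by linarith [hform 1 1, hform 1 (-1)]
    refine ⟨m₁, m₂, m₃, m₄, 0, 0, 0, ⟨hm₁, hm₂, hm₃, hm₄, le_rfl, by linarith, by norm_num⟩, ?_⟩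
    rw [hν, paramState_eq_realSymm (by simp)]
    simp
  · refine ⟨m₁, m₂, m₃, m₄, u + v, 2 * w / (u + v), (u - v) / (u + v),
      ⟨hm₁, hm₂, hm₃, hm₄, h.le, by linarith, ?_⟩, ?_⟩
    · have hdet : 0 ≤ (u + v) * (u * v - w ^ 2) := by
        linarith [hform w (-u), hform v (-w)]
      have hdet' := nonneg_of_mul_nonneg_right hdet h
      rw [div_pow, div_pow, zero_pow two_ne_zero, add_zero, ← add_div, div_le_one (by positivity)]
      linarith
    · rw [hν, paramState_eq_realSymm (by simp)]
      congr 1 <;> field_simp <;> ring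

/-! ### The example -/

theorem isParam_example : IsParam 0 0 (1 / 4) (1 / 4) (1 / 2) 1 0 0 := by
  norm_num [IsParam]

theorem tvDist_counit_haar_le_one : tvDist counit haar ≤ 1 := by
  rw [counit_eq_realSymm]
  obtain ⟨T, h₀, h₁, h₂⟩ := exists_tvDist_realSymm_haar 1 0 0 0 0 0 0
  have hT : T ≤ 1 / 2 := abs_le_of_sq_le_sq' (by linarith) (by norm_num) |>.2
  rw [h₂]
  norm_num [abs_of_pos, abs_of_neg]
  linarith

theorem exampleState_eq_realSymm :
    exampleState = realSymm 0 0 (1 / 4) (1 / 4) (1 / 4) (1 / 4) (1 / 4) := by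
  rw [exampleState_eq_paramState, paramState_eq_realSymm (by simp)]
  norm_num

theorem tvDist_convPow_exampleState_le (k : ℕ) :
    tvDist (convPow exampleState k) haar ≤ ((√3 + 1) / 4) ^ k := by
  -- At `k = 0` the bound of (b) is `7/4`, too weak; for `k > 0` its first three terms vanish.
  rcases k.eq_zero_or_pos with rfl | hk
  · simpa [convPow] using tvDist_counit_haar_le_one
  have h3 : √3 ^ 2 = 3 := Real.sq_sqrt (by norm_num)
  have h1 : 1 ≤ √3 := Real.one_le_sqrt.2 (by norm_num)
  refine le_of_sq_le_sq ?_ (by positivity)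
  rw [exampleState_eq_realSymm]
  refine (sq_tvDist_convPow_realSymm_le (D := √3 / 4) (by norm_num) (by linarith) k).trans ?_
  have h₁ : ((0 : ℝ) - 1 / 4 + √3 / 4) ^ (2 * k) ≤ ((√3 + 1) / 4) ^ (2 * k) :=
    pow_le_pow_left₀ (by linarith) (by linarith) _
  have h₂ : ((0 : ℝ) - 1 / 4 - √3 / 4) ^ (2 * k) = ((√3 + 1) / 4) ^ (2 * k) := by
    rw [show (0 : ℝ) - 1 / 4 - √3 / 4 = -((√3 + 1) / 4) by ring, (even_two_mul k).neg_pow]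
  rw [h₂, ← pow_mul, mul_comm k 2]
  norm_num [hk.ne'] at h₁ ⊢
  linarith

theorem rpow_neg_half_eq {c d : ℝ} (hd : 0 ≤ d) (h : d ^ 2 * c = 1) (k : ℕ) :
    c ^ (-(k : ℝ) / 2) = d ^ k := by
  have hcd : c = d ^ (-2 : ℝ) := by
    rw [Real.rpow_neg hd, Real.rpow_two]
    exact eq_inv_of_mul_eq_one_right h
  rw [hcd, ← Real.rpow_mul hd, ← Real.rpow_natCast]
  congr 1
  ring

theorem le_tvDist_convPow_exampleState (k : ℕ) :
    1 / (2 * √6) * ((8 * (2 - √3)) ^ (-(k : ℝ) / 2) - (8 * (2 + √3)) ^ (-(k : ℝ) / 2)) ≤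
      tvDist (convPow exampleState k) haar := by
  have h3 : √3 ^ 2 = 3 := Real.sq_sqrt (by norm_num)
  have h1 : 1 ≤ √3 := Real.one_le_sqrt.2 (by norm_num)
  have h2 : √3 < 2 := by rw [Real.sqrt_lt' (by norm_num)]; norm_num
  have h6 : 2 ≤ √6 := Real.le_sqrt_of_sq_le (by norm_num)
  rw [rpow_neg_half_eq (d := (√3 + 1) / 4) (by linarith) (by nlinarith),
    rpow_neg_half_eq (d := (√3 - 1) / 4) (by linarith) (by nlinarith),
    exampleState_eq_realSymm]
  obtain ⟨n₁, n₂, n₃, n₄, s, t, b, h₀, -, -, -, -, -, h₆, h₇⟩ :=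
    exists_convPow_realSymm (m₁ := 0) (m₂ := 0) (m₃ := 1 / 4) (m₄ := 1 / 4) (u := 1 / 4)
      (v := 1 / 4) (w := 1 / 4) (D := √3 / 4) (by norm_num) (by linarith) k
  obtain ⟨T, hT, -, h⟩ := exists_tvDist_realSymm_haar n₁ n₂ n₃ n₄ s t (b * (1 / 4))
  rw [h₀, h]
  have hd : |n₁ - n₄| ≤ |n₁ - 1 / 8| + |n₄ - 1 / 8| := by
    simpa [abs_sub_comm n₄] using abs_sub_le n₁ (1 / 8) n₄
  have hle : ((√3 - 1) / 4) ^ k ≤ ((√3 + 1) / 4) ^ k :=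
    pow_le_pow_left₀ (by linarith) (by linarith) k
  -- `2 (n₁ - n₄)` is the sum of the `k`-th powers of the eigenvalues `(-1 ± √3) / 4`.
  have hg : ((√3 + 1) / 4) ^ k - ((√3 - 1) / 4) ^ k ≤ 2 * |n₁ - n₄| := by
    have e₁ : |((0 : ℝ) - 1 / 4 - √3 / 4) ^ k| = ((√3 + 1) / 4) ^ k := by
      rw [abs_pow, abs_of_neg (by linarith)]
      ring
    have e₂ : |((0 : ℝ) - 1 / 4 + √3 / 4) ^ k| = ((√3 - 1) / 4) ^ k := by
      rw [abs_pow, abs_of_nonneg (by linarith)]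
      ring
    rw [← e₁, ← e₂, ← h₆, ← h₇]
    calc _ ≤ |(n₁ - n₄ - b * (√3 / 4)) - -(n₁ - n₄ + b * (√3 / 4))| := by
          simpa only [abs_neg] using
            abs_sub_abs_le_abs_sub (n₁ - n₄ - b * (√3 / 4)) (-(n₁ - n₄ + b * (√3 / 4)))
      _ = 2 * |n₁ - n₄| := by
          rw [show (n₁ - n₄ - b * (√3 / 4)) - -(n₁ - n₄ + b * (√3 / 4)) = 2 * (n₁ - n₄) by ring,
            abs_mul, abs_two]
  have h4 : 1 / (2 * √6) ≤ 1 / 4 := one_div_le_one_div_of_le (by norm_num) (by linarith)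
  have := mul_le_mul_of_nonneg_right h4 (sub_nonneg.2 hle)
  linarith [abs_nonneg (n₂ - 1 / 8), abs_nonneg (n₃ - 1 / 8)]

end KacPaljutkin

theorem mainTheorem9 :
    -- the symmetric states are exactly the states with parameters `μᵢ`, `x`, `z` (and `y = 0`)
    (∀ ν : KacPaljutkin.Dual,
      (KacPaljutkin.IsState ν ∧ KacPaljutkin.IsSymmetric ν) ↔
        ∃ μ₁ μ₂ μ₃ μ₄ μ₅ x z : ℝ, KacPaljutkin.IsParam μ₁ μ₂ μ₃ μ₄ μ₅ x 0 z ∧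
          ν = KacPaljutkin.paramState μ₁ μ₂ μ₃ μ₄ μ₅ x 0 z) ∧
    -- the upper bound, for every parametrisation of a symmetric state
    (∀ μ₁ μ₂ μ₃ μ₄ μ₅ x y z : ℝ, KacPaljutkin.IsParam μ₁ μ₂ μ₃ μ₄ μ₅ x y z →
      KacPaljutkin.IsSymmetric (KacPaljutkin.paramState μ₁ μ₂ μ₃ μ₄ μ₅ x y z) →
      ∀ k : ℕ,
        KacPaljutkin.tvDist
            (KacPaljutkin.convPow (KacPaljutkin.paramState μ₁ μ₂ μ₃ μ₄ μ₅ x y z) k)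
            KacPaljutkin.haar ^ 2 ≤
          1 / 4 * (μ₁ - μ₂ - μ₃ + μ₄ - z * μ₅) ^ (2 * k)
          + 1 / 4 * (μ₁ - μ₂ - μ₃ + μ₄ + z * μ₅) ^ (2 * k)
          + 1 / 4 * (μ₁ + μ₂ + μ₃ + μ₄ - μ₅) ^ (2 * k)
          + 1 / 2 * (μ₁ - μ₄ + √((μ₂ - μ₃) ^ 2 + μ₅ ^ 2 * x ^ 2 / 2)) ^ (2 * k)
          + 1 / 2 * (μ₁ - μ₄ - √((μ₂ - μ₃) ^ 2 + μ₅ ^ 2 * x ^ 2 / 2)) ^ (2 * k)) ∧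
    -- the example
    (KacPaljutkin.IsState KacPaljutkin.exampleState ∧
      KacPaljutkin.IsSymmetric KacPaljutkin.exampleState ∧
      ∀ k : ℕ,
        1 / (2 * √6) * ((8 * (2 - √3)) ^ (-(k : ℝ) / 2) - (8 * (2 + √3)) ^ (-(k : ℝ) / 2)) ≤
            KacPaljutkin.tvDist (KacPaljutkin.convPow KacPaljutkin.exampleState k)
              KacPaljutkin.haar ∧
        KacPaljutkin.tvDist (KacPaljutkin.convPow KacPaljutkin.exampleState k)
            KacPaljutkin.haar ≤ ((√3 + 1) / 4) ^ k) := by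
  open KacPaljutkin in
  refine ⟨fun ν => ⟨fun h => exists_paramState h.1 h.2, ?_⟩, ?_, ?_, ?_, fun k =>
    ⟨le_tvDist_convPow_exampleState k, tvDist_convPow_exampleState_le k⟩⟩
  · rintro ⟨μ₁, μ₂, μ₃, μ₄, μ₅, x, z, h, rfl⟩
    refine ⟨isState_paramState h, ?_⟩
    rw [paramState_eq_realSymm (by simp)]
    exact isSymmetric_realSymm ..
  · intro μ₁ μ₂ μ₃ μ₄ μ₅ x y z h hS k
    obtain ⟨-, -, -, -, -, hsum, -⟩ := h
    rw [paramState_eq_realSymm (mul_eq_zero_of_isSymmetric hS)]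
    refine (sq_tvDist_convPow_realSymm_le (D := √((μ₂ - μ₃) ^ 2 + μ₅ ^ 2 * x ^ 2 / 2))
      (by linarith) (by rw [Real.sq_sqrt (by positivity)]; ring) k).trans_eq ?_
    ring_nf
  · rw [exampleState_eq_paramState]
    exact isState_paramState isParam_example
  · rw [exampleState_eq_realSymm]
    exact isSymmetric_realSymm ..
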